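/- Let $\mathcal A=\{a,b,c\}$ and let $\gamma:\mathcal A^*\to\mathcal A^*$ be the morphism of the free monoid with $\gamma(a)=aca$, $\gamma(b)=cab$, $\gamma(c)=b$. Definitions. A morphism $\varphi:\mathcal A^*\to\mathcal A^*$ (a monoid endomorphism, possibly erasing) is *primitive* if for some $k$ every $\varphi^k(\alpha)$, $\alpha\in\mathcal A$, contains every letter. For $\mathbf x,\mathbf y\in\mathcal A^{\mathbb N}$ we write $\varphi(\mathbf x)=\mathbf y$ if the concatenation $\varphi(x_0)\varphi(x_1)\varphi(x_2)\cdots$ is infinite and equals $\mathbf y$; $\mathrm{Stab}(\mathbf x)$ is the set of morphisms $\varphi$ with $\varphi(\mathbf x)=\mathbf x$. A word is a *palindrome* if it equals its reversal (the empty word is one), and an infinite word is *palindromic* if it has arbitrarily long palindromic factors. Two morphisms $\varphi,\varphi'$ are *conjugate* if there is a word $w\in\mathcal A^*$ such that $\varphi(u)w=w\varphi'(u)$ for all $u\in\mathcal A^*$, or such that $\varphi'(u)w=w\varphi(u)$ for all $u\in\mathcal A^*$. A morphism $\varphi$ is in *class $\mathcal P$* if there are a palindrome $p$ and, for each letter $\alpha$,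 a palindrome $q_\alpha$ with $\varphi(\alpha)=pq_\alpha$. Theorem. The morphism $\gamma$ is primitive. The infinite word $\mathbf x_\gamma$ whose prefixes are the words $\gamma^n(a)$ starts with $a$, satisfies $\gamma(\mathbf x_\gamma)=\mathbf x_\gamma$, and is the only infinite word with these two properties. Moreover: 1. $\mathbf x_\gamma$ is palindromic; 2. no morphism $\varphi\in\mathrm{Stab}(\mathbf x_\gamma)$ with $\varphi\neq\mathrm{Id}$ has a conjugate in class $\mathcal P$. Consequently the following assertion, the Hof–Knill–Simon question as reformulated by Blondin Massé and Labbé, is false over the three-letter alphabet: "every fixed point $\mathbf u\in\mathcal A^{\mathbb N}$ of a primitive morphism is palindromic if and only if there is a morphism $\varphi\neq\mathrm{Id}$ with $\varphi(\mathbf u)=\mathbf u$ that has a conjugate in class $\mathcal P$." -/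

import Mathlib

namespace HKS

/-- Words over the alphabet `A` are the elements of the free monoid `FreeMonoid A`.
A morphism is an endomorphism of that monoid; product is composition and `1` is the identity. -/
abbrev Morphism (A : Type*) : Type _ := Monoid.End (FreeMonoid A)

/-- A word that equals its reversal. -/
def IsPalindrome {A : Type*} (w : FreeMonoid A) : Prop :=
  w.toList.reverse = w.toList

/-- The word `x m, x (m + 1), …, x (m + n - 1)` occurring in the infinite word `x`. -/
def factorAt {A : Type*} (x : ℕ → A) (m n : ℕ) : FreeMonoid A :=
  FreeMonoid.ofList ((List.range n).map fun i => x (m + i))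

/-- The set of all (finite) factors of an infinite word. -/
def language {A : Type*} (x : ℕ → A) : Set (FreeMonoid A) :=
  {f | ∃ m n : ℕ, f = factorAt x m n}

/-- The language of `x` contains arbitrarily long palindromes. -/
def IsPalindromic {A : Type*} (x : ℕ → A) : Prop :=
  ∀ n : ℕ, ∃ f ∈ language x, IsPalindrome f ∧ n ≤ f.length

/-- `φ(x) = y` for infinite words `x` and `y`: the concatenation `φ(x 0) φ(x 1) φ(x 2) ⋯` is
infinite and equals `y`. (For an erasing `φ` that concatenation may be finite.) -/
def MapsTo {A : Type*} (φ : Morphism A) (x y : ℕ → A) : Prop :=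
  (∀ n : ℕ, φ (factorAt x 0 n) = factorAt y 0 (φ (factorAt x 0 n)).length) ∧
    ∀ m : ℕ, ∃ n : ℕ, m ≤ (φ (factorAt x 0 n)).length

/-- The stabilizer of an infinite word: the morphisms `φ` with `φ(x) = x`. -/
def Stab {A : Type*} (x : ℕ → A) : Set (Morphism A) :=
  {φ | MapsTo φ x x}

/-- Some power of `φ` maps every letter to a word containing every letter. -/
def IsPrimitive {A : Type*} (φ : Morphism A) : Prop :=
  ∃ k : ℕ, ∀ α β : A, β ∈ ((φ ^ k) (FreeMonoid.of α)).toList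

/-- `φ` is a right conjugate of `ψ`. -/
def IsRightConjugate {A : Type*} (φ ψ : Morphism A) : Prop :=
  ∃ w : FreeMonoid A, ∀ u : FreeMonoid A, φ u * w = w * ψ u

/-- Two morphisms are conjugate if one of them is a right conjugate of the other. -/
def AreConjugate {A : Type*} (φ ψ : Morphism A) : Prop :=
  IsRightConjugate φ ψ ∨ IsRightConjugate ψ φ

/-- Class P: there are a palindrome `p` and palindromes `q_α` with `φ(α) = p q_α` for
every letter `α`. -/
def ClassP {A : Type*} (φ : Morphism A) : Prop :=
  ∃ p : FreeMonoid A, IsPalindrome p ∧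
    ∀ α : A, ∃ q : FreeMonoid A, IsPalindrome q ∧ φ (FreeMonoid.of α) = p * q

/-- `φ` has a conjugate in class P. -/
def HasConjugateInClassP {A : Type*} (φ : Morphism A) : Prop :=
  ∃ ψ : Morphism A, AreConjugate φ ψ ∧ ClassP ψ

/-- The reformulated Hof–Knill–Simon question, as an assertion about the alphabet `A`: a fixed
point `u` of a primitive morphism is palindromic if and only if some morphism other than the
identity fixes `u` and has a conjugate in class P. -/
def HofKnillSimonAssertion (A : Type*) : Prop :=
  ∀ (φ : Morphism A) (u : ℕ → A), IsPrimitive φ → MapsTo φ u u →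
    (IsPalindromic u ↔ ∃ ψ ∈ Stab u, ψ ≠ 1 ∧ HasConjugateInClassP ψ)

/-- The ternary alphabet `{a, b, c}`. -/
inductive Letter : Type
  | a
  | b
  | c

/-- The images of the letters: `a ↦ aca`, `b ↦ cab`, `c ↦ b`. -/
def gammaLetter : Letter → FreeMonoid Letter
  | .a => FreeMonoid.ofList [.a, .c, .a]
  | .b => FreeMonoid.ofList [.c, .a, .b]
  | .c => FreeMonoid.ofList [.b]

/-- The morphism `γ : a ↦ aca, b ↦ cab, c ↦ b`. -/
def gamma : Morphism Letter :=
  FreeMonoid.lift gammaLetter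

/-- The infinite word whose prefixes are the words `γⁿ(a)`. As `γⁿ(a)` is a prefix of `γⁿ⁺¹(a)`
and has more than `n` letters, the letter at index `n` can be read off `γⁿ(a)`, and the default
value of `getD` is never used. -/
def xGamma (n : ℕ) : Letter :=
  ((gamma ^ n) (FreeMonoid.of Letter.a)).toList.getD n Letter.a

end HKS

namespace HKS

/-! Since γ(ac) = acab and γ(ab) = acacab, `xGamma` is the letter a alternating with the letters of
a binary word t (c read as 0 = false, b as 1 = true) fixed by `subst`: 0 ↦ 01, 1 ↦ 001. In each
image the only 1 is the last letter, so words ending in 1 desubstitute uniquely, and most arguments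
are descents along this.

Palindromes: if u is a palindrome, so is 1·subst(u), and interleaving with a keeps the symmetry.

Stabilizer: a morphism φ fixing `xGamma` sends ac and ab to interleavings of words f and g, and 0 ↦
f, 1 ↦ g fixes t. As t is not periodic, f and g are nonempty; as t avoids 000 and 001001, either
both end in 1 and desubstitute, or f = 0 and g = 1. Hence f and g are the images of 0 and 1 under a
power `subst^[k]` (`exists_iterate_of_stab`, `exists_iterate_of_mem_stab`).

Class P: a conjugate in class P yields one word V, with |V| of the parity of |p|, such that either
φ(α)V = Vφ(α)~ for all letters or φ(α)~V = Vφ(α) for all letters, where ~ is reversal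
(`exists_semiconj_reverse`). For k > 0 the first form contradicts `eq_zero_of_semiconj_reverse`; the
second contradicts `not_reverse_semiconj` unless some φ(α) is empty and |V| is odd, but an empty
φ(α) makes p empty and |V| even. For k = 0, φ is the identity or φ(a) is empty, and parity decides
again. -/

/-! ### The binary substitution and its desubstitution. -/

/-- The binary substitution `false ↦ false true`, `true ↦ false false true` on letters. -/
def sub : Bool → List Bool
  | false => [false, true]
  | true => [false, false, true]

/-- The binary substitution on words. -/
def subst (l : List Bool) : List Bool := l.flatMap sub

@[simp] theorem subst_nil : subst [] = [] := rfl

@[simp] theorem subst_append (u v : List Bool) : subst (u ++ v) = subst u ++ subst v :=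
  List.flatMap_append

@[simp] theorem subst_cons_false (v : List Bool) :
    subst (false :: v) = false :: true :: subst v := rfl

@[simp] theorem subst_cons_true (v : List Bool) :
    subst (true :: v) = false :: false :: true :: subst v := rfl

theorem length_le_length_subst (u : List Bool) : 2 * u.length ≤ (subst u).length := by
  induction u with
  | nil => simp
  | cons x u ih => cases x <;> simp <;> omega

/-- The images 01 and 001 form a prefix code: their second letters differ. -/
theorem prefix_of_subst_prefix {u v : List Bool} (h : subst u <+: subst v) : u <+: v := by
  induction u generalizing v with
  | nil => simp
  | cons x u ih =>
    cases v with
    | nil => cases x <;> simp at h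
    | cons z v =>
      cases x <;> cases z <;> simp [List.cons_prefix_cons] at h ⊢ <;> exact ih h

theorem subst_injective : Function.Injective subst := fun u v h =>
  (prefix_of_subst_prefix (h ▸ List.prefix_rfl)).eq_of_length_le
    (prefix_of_subst_prefix (h ▸ List.prefix_rfl : subst v <+: subst u)).length_le

theorem subst_eq_append_singleton {u l : List Bool} {x : Bool} (h : subst u = l ++ [x]) :
    x = true := by
  rcases List.eq_nil_or_concat u with rfl | ⟨u', z, rfl⟩
  · simp at h
  · have := congrArg List.getLast? h
    cases z <;> simpa [subst, sub] using this.symm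

/-- Every true closes an image, so a cut after a true falls between images. The tail `r` makes room
for the final false in `pref`. -/
theorem eq_subst_of_prefix {l v r : List Bool} (h : l ++ [true] <+: subst v ++ r)
    (hr : ∀ x ∈ r, x = false) : ∃ u, l ++ [true] = subst u ∧ u <+: v := by
  induction v generalizing l with
  | nil =>
    have := hr true (h.subset (by simp))
    simp at this
  | cons z v ih =>
    cases z
    · rcases l with _ | ⟨x, _ | ⟨x', l⟩⟩
      · simp [List.cons_prefix_cons] at h
      · simp [List.cons_prefix_cons] at h
        exact ⟨[false], by simp [h], by simp [List.cons_prefix_cons]⟩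
      · simp [List.cons_prefix_cons] at h
        obtain ⟨rfl, rfl, h⟩ := h
        obtain ⟨u, hu, huv⟩ := ih h
        exact ⟨false :: u, by simp [← hu], by simpa [List.cons_prefix_cons] using huv⟩
    · rcases l with _ | ⟨x, _ | ⟨x', _ | ⟨x'', l⟩⟩⟩
      · simp [List.cons_prefix_cons] at h
      · simp [List.cons_prefix_cons] at h
      · simp [List.cons_prefix_cons] at h
        exact ⟨[true], by simp [h], by simp [List.cons_prefix_cons]⟩
      · simp [List.cons_prefix_cons] at h
        obtain ⟨rfl, rfl, rfl, h⟩ := h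
        obtain ⟨u, hu, huv⟩ := ih h
        exact ⟨true :: u, by simp [← hu], by simpa [List.cons_prefix_cons] using huv⟩

/-! ### The binary fixed point and factors that it avoids. -/

/-- An increasing sequence of prefixes of the fixed point of `subst`. -/
def pref : ℕ → List Bool
  | 0 => []
  | n + 1 => subst (pref n) ++ [false]

/-- `l` is a prefix of the fixed point of `subst`. -/
def IsPre (l : List Bool) : Prop := ∃ n, l <+: pref n

theorem subst_prefix_of_prefix {u v : List Bool} (h : u <+: v) : subst u <+: subst v := by
  obtain ⟨t, rfl⟩ := h
  simp

/-- Both images begin with false, so the appended false is correct whichever image comes next. -/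
theorem pref_prefix_succ (n : ℕ) : pref n <+: pref (n + 1) := by
  induction n with
  | zero => simp [pref]
  | succ n ih =>
    obtain ⟨t, ht⟩ := ih
    rw [pref, pref]
    rw [← ht, subst_append]
    rcases t with _ | ⟨x, t⟩
    · simp
    · cases x <;> simp [List.cons_prefix_cons]

theorem pref_prefix_of_le {m n : ℕ} (h : m ≤ n) : pref m <+: pref n := by
  induction h with
  | refl => exact List.prefix_rfl
  | step _ ih => exact ih.trans (pref_prefix_succ _)

theorem IsPre.of_prefix {l l' : List Bool} (h : IsPre l') (hl : l <+: l') : IsPre l :=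
  let ⟨n, hn⟩ := h
  ⟨n, hl.trans hn⟩

theorem IsPre.of_append {l l' : List Bool} (h : IsPre (l ++ l')) : IsPre l :=
  h.of_prefix (List.prefix_append _ _)

theorem IsPre.total {l l' : List Bool} (h : IsPre l) (h' : IsPre l') : l <+: l' ∨ l' <+: l := by
  obtain ⟨m, hm⟩ := h
  obtain ⟨n, hn⟩ := h'
  exact List.prefix_or_prefix_of_prefix (hm.trans (pref_prefix_of_le (le_max_left m n)))
    (hn.trans (pref_prefix_of_le (le_max_right m n)))

theorem IsPre.subst {l : List Bool} (h : IsPre l) : IsPre (subst l) := by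
  obtain ⟨n, hn⟩ := h
  exact ⟨n + 1, (subst_prefix_of_prefix hn).trans (List.prefix_append _ _)⟩

theorem IsPre.exists_prefix_subst {l : List Bool} (h : IsPre l) :
    ∃ n, l <+: HKS.subst (pref n) ++ [false] := by
  obtain ⟨n, hn⟩ := h
  exact ⟨n, hn.trans (pref_prefix_succ n)⟩

theorem IsPre.exists_eq_subst {l : List Bool} (h : IsPre (l ++ [true])) :
    ∃ u, l ++ [true] = HKS.subst u ∧ IsPre u := by
  obtain ⟨n, hn⟩ := h.exists_prefix_subst
  obtain ⟨u, hu, hun⟩ := eq_subst_of_prefix hn (by simp)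
  exact ⟨u, hu, n, hun⟩

theorem IsPre.of_subst {u : List Bool} (h : IsPre (HKS.subst u)) : IsPre u := by
  rcases List.eq_nil_or_concat (HKS.subst u) with hu | ⟨l, x, hl⟩
  · have := length_le_length_subst u
    rw [hu] at this
    exact ⟨0, by simpa [pref] using this⟩
  · rw [List.concat_eq_append] at hl
    obtain rfl := subst_eq_append_singleton hl
    rw [hl] at h
    obtain ⟨u', hu', h'⟩ := h.exists_eq_subst
    rwa [subst_injective (hl.trans hu')]

theorem isPre_start :
    IsPre [false, true, false, false, true, false, true, false, true, false, false, true] :=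
  ⟨5, by decide⟩

theorem not_isPre_true_true (l : List Bool) : ¬ IsPre (l ++ [true, true]) := by
  intro h
  rw [show l ++ [true, true] = (l ++ [true]) ++ [true] by simp] at h
  obtain ⟨u, hu, -⟩ := h.exists_eq_subst
  rcases List.eq_nil_or_concat u with rfl | ⟨u', z, rfl⟩
  · simp at hu
  · have := congrArg List.reverse hu
    cases z <;> simp at this

theorem not_three_false_prefix (l v : List Bool) :
    ¬ l ++ [false, false, false] <+: subst v ++ [false] := by
  induction v generalizing l with
  | nil => intro h; have := h.length_le; simp at this
  | cons z v ih =>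
    intro h
    cases z
    · rcases l with _ | ⟨x, _ | ⟨x', l⟩⟩ <;> simp [List.cons_prefix_cons] at h
      exact ih _ (by simpa using h.2.2)
    · rcases l with _ | ⟨x, _ | ⟨x', _ | ⟨x'', l⟩⟩⟩ <;> simp [List.cons_prefix_cons] at h
      exact ih _ (by simpa using h.2.2.2)

theorem not_isPre_three_false (l : List Bool) : ¬ IsPre (l ++ [false, false, false]) := by
  intro h
  obtain ⟨n, hn⟩ := h.exists_prefix_subst
  exact not_three_false_prefix _ _ hn

/-- Both blocks 001 would have to be images of true, giving the factor 11 one level down. -/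
theorem not_isPre_square (l : List Bool) :
    ¬ IsPre (l ++ [false, false, true, false, false, true]) := by
  intro h
  rw [show l ++ [false, false, true, false, false, true] =
    (l ++ [false, false, true, false, false]) ++ [true] by simp] at h
  obtain ⟨u, hu, hp⟩ := h.exists_eq_subst
  rcases List.eq_nil_or_concat u with rfl | ⟨u, z, rfl⟩
  · simp at hu
  rw [List.concat_eq_append] at *
  cases z
  · have h1 : l ++ [false, false, true, false] = subst u :=
      List.append_inj_left' (t₁ := [false, true]) (t₂ := [false, true]) (by simpa using hu) rfl
    have := subst_eq_append_singleton (l := l ++ [false, false, true]) (x := false)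
      (by rw [← h1]; simp)
    simp at this
  · have h1 : l ++ [false, false, true] = subst u :=
      List.append_inj_left' (t₁ := [false, false, true]) (t₂ := [false, false, true])
        (by simpa using hu) rfl
    rcases List.eq_nil_or_concat u with rfl | ⟨u, z, rfl⟩
    · simp at h1
    rw [List.concat_eq_append] at *
    cases z
    · have h2 : l ++ [false] = subst u :=
        List.append_inj_left' (t₁ := [false, true]) (t₂ := [false, true])
          (by simpa using h1) rfl
      simpa using subst_eq_append_singleton h2.symm
    · exact not_isPre_true_true u (by simpa using hp)

theorem IsPre.total_start {l : List Bool} (h : IsPre l) :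
    l <+: [false, true, false, false, true, false, true, false, true, false, false, true] ∨
      [false, true, false, false, true, false, true, false, true, false, false, true] <+: l :=
  h.total isPre_start

/-! ### Aperiodicity and the stabilizer of the binary fixed point. -/

/-- A prefix ending in `false` whose square occurs in the fixed point is `false` or
`false true false`. -/
theorem eq_of_square_of_last_false {C s r : List Bool} (h : IsPre (C ++ [false]))
    (h2 : IsPre (s ++ (C ++ [false]) ++ (C ++ [false]) ++ r)) :
    C = [] ∨ C = [false, true] := by
  rcases C with _ | ⟨c0, _ | ⟨c1, _ | ⟨c2, _ | ⟨c3, _ | ⟨c4, C⟩⟩⟩⟩⟩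
  · simp
  · simpa [List.cons_prefix_cons] using h.total_start
  · have := h.total_start
    simp [List.cons_prefix_cons] at this
    simp [this]
  · have := h.total_start
    simp [List.cons_prefix_cons] at this
    obtain ⟨rfl, rfl, rfl⟩ := this
    exact absurd (h2.of_prefix ⟨[true, false, false] ++ r, by simp⟩)
      (not_isPre_three_false (s ++ [false, true]))
  · have := h.total_start
    simp [List.cons_prefix_cons] at this
  · have : c0 = false ∧ c1 = true ∧ c2 = false ∧ c3 = false ∧ c4 = true := by
      have := h.total_start
      simp [List.cons_prefix_cons] at this
      rcases this with h | h <;> simp [h]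
    obtain ⟨rfl, rfl, rfl, rfl, rfl⟩ := this
    exact absurd (h2.of_prefix ⟨C ++ [false] ++ r, by simp⟩)
      (not_isPre_square (s ++ [false, true, false, false, true] ++ C))

/-- Descent on the period: one ending in true desubstitutes to a shorter one; one ending in false is
0 or 010, and neither cube is a prefix. -/
theorem eq_nil_of_forall_isPre_replicate {f : List Bool}
    (h : ∀ n, IsPre (List.replicate n f).flatten) : f = [] := by
  induction hn : f.length using Nat.strong_induction_on generalizing f with
  | _ n ih =>
  subst hn
  by_contra hf
  obtain ⟨C, x, rfl⟩ := List.eq_nil_or_concat f |>.resolve_left hf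
  rw [List.concat_eq_append] at *
  have h1 := h 1
  have h3 := h 3
  simp [List.replicate] at h1 h3
  cases x
  · rcases eq_of_square_of_last_false (s := []) (r := C ++ [false]) h1 (by simpa using h3)
      with rfl | rfl
    · exact not_isPre_three_false [] (by simpa using h3)
    · simpa [List.cons_prefix_cons] using h3.total_start
  · obtain ⟨u, hu, hp⟩ := h1.exists_eq_subst
    have hl := length_le_length_subst u
    rw [← hu] at hl
    have : u ≠ [] := by rintro rfl; simp at hu
    have h0 : 0 < u.length := List.length_pos_iff.2 this
    refine this (ih u.length (by omega) (fun n => ?_) rfl)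
    refine IsPre.of_subst ?_
    have := h n
    rw [hu] at this
    convert this using 1
    clear this
    induction n with
    | zero => simp
    | succ n ih => simp [List.replicate_succ, ih]

/-- The morphism on binary words with the given images of `false` and `true`. -/
def morph (f g : List Bool) (l : List Bool) : List Bool :=
  l.flatMap fun x => bif x then g else f

@[simp] theorem morph_nil (f g : List Bool) : morph f g [] = [] := rfl

@[simp] theorem morph_cons_false (f g l : List Bool) :
    morph f g (false :: l) = f ++ morph f g l := rfl

@[simp] theorem morph_cons_true (f g l : List Bool) :
    morph f g (true :: l) = g ++ morph f g l := rfl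

theorem subst_morph (f g l : List Bool) :
    subst (morph f g l) = morph (subst f) (subst g) l := by
  induction l with
  | nil => simp
  | cons x l ih => cases x <;> simp [ih]

/-- With f = `C ++ [false]`, the square ff occurs in f g f f g ⋯, which leaves f = 0 or f = 010. If
f = 010, then g begins with 01; if f = 0 and g has at least four letters, then g begins with 1001.
Either way ffg contains 001001. -/
theorem stab_false_last {C g : List Bool} (hg : g ≠ [])
    (h : ∀ l, IsPre l → IsPre (morph (C ++ [false]) g l)) : C = [] ∧ g = [true] := by
  have h1 : IsPre (C ++ [false]) := (h _ isPre_start).of_append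
  have h4 := h _ isPre_start
  simp at h4
  rcases eq_of_square_of_last_false (s := C ++ [false] ++ g) (r := g) h1
    (h4.of_prefix (by simp [List.prefix_append_right_inj, List.cons_prefix_cons])) with rfl | rfl
  · refine ⟨rfl, ?_⟩
    rcases g with _ | ⟨g0, _ | ⟨g1, _ | ⟨g2, _ | ⟨g3, g⟩⟩⟩⟩
    · exact absurd rfl hg
    · simpa [List.cons_prefix_cons] using h4.total_start
    · simpa [List.cons_prefix_cons] using h4.total_start
    · simpa [List.cons_prefix_cons] using h4.total_start
    · exfalso
      have := h4.total_start
      simp [List.cons_prefix_cons] at this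
      have : g0 = true ∧ g1 = false ∧ g2 = false ∧ g3 = true := by
        rcases this with h | h <;> simp [h]
      obtain ⟨rfl, rfl, rfl, rfl⟩ := this
      exact absurd (h4.of_prefix (by simp [List.prefix_append_right_inj, List.cons_prefix_cons]))
        (not_isPre_square (false :: (true :: false :: false :: true :: g)))
  · exfalso
    rcases g with _ | ⟨g0, _ | ⟨g1, g⟩⟩
    · exact absurd rfl hg
    · have := h4.total_start
      simp [List.cons_prefix_cons] at this
    · have := h4.total_start
      simp [List.cons_prefix_cons] at this
      have : g0 = false ∧ g1 = true := by
        rcases this with h | h <;> simp [h]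
      obtain ⟨rfl, rfl⟩ := this
      exact absurd (h4.of_prefix (by simp [List.prefix_append_right_inj, List.cons_prefix_cons]))
        (not_isPre_square ([false, true, false] ++ (false :: true :: g) ++ [false, true]))

/-- If the image f of false has at least five letters, it begins with 01001 and gf contains 0·01001.
The only shorter prefix ending in true is 01; then g begins with 001 and gfg contains 0·01·001. -/
theorem not_stab_true_last_false_last {C X : List Bool}
    (h : ∀ l, IsPre l → IsPre (morph (C ++ [true]) (X ++ [false]) l)) : False := by
  have h1 : IsPre (C ++ [true]) := (h _ isPre_start).of_append
  have h4 := h _ isPre_start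
  simp only [morph_cons_false, morph_cons_true] at h4
  rcases C with _ | ⟨c0, _ | ⟨c1, _ | ⟨c2, _ | ⟨c3, C⟩⟩⟩⟩
  · simpa [List.cons_prefix_cons] using h1.total_start
  · obtain rfl : c0 = false := by simpa [List.cons_prefix_cons] using h1.total_start
    rcases X with _ | ⟨x0, _ | ⟨x1, _ | ⟨x2, X⟩⟩⟩
    · simpa [List.cons_prefix_cons] using h4.total_start
    · simpa [List.cons_prefix_cons] using h4.total_start
    · simpa [List.cons_prefix_cons] using h4.total_start
    · have := h4.total_start
      simp [List.cons_prefix_cons] at this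
      have : x0 = false ∧ x1 = false ∧ x2 = true := by
        rcases this with h | h <;> simp [h]
      obtain ⟨rfl, rfl, rfl⟩ := this
      refine not_isPre_square ([false, true] ++ (false :: false :: true :: X) ++ [false] ++
        [false, true] ++ [false, true] ++ (false :: false :: true :: X)) (h4.of_prefix ?_)
      simp [List.prefix_append_right_inj, List.cons_prefix_cons]
  · simpa [List.cons_prefix_cons] using h1.total_start
  · simpa [List.cons_prefix_cons] using h1.total_start
  · obtain ⟨c, R, hR⟩ : ∃ c R, C ++ [true] = c :: R := by cases C <;> simp
    simp only [List.cons_append, hR] at h1 h4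
    have := h1.total_start
    simp [List.cons_prefix_cons] at this
    have : c0 = false ∧ c1 = true ∧ c2 = false ∧ c3 = false ∧ c = true := by
      rcases this with h | h <;> simp [h]
    obtain ⟨rfl, rfl, rfl, rfl, rfl⟩ := this
    refine not_isPre_square ((false :: true :: false :: false :: true :: R) ++ X)
      (h4.of_prefix ?_)
    simp [List.prefix_append_right_inj, List.cons_prefix_cons]

theorem ne_nil_of_subst_eq_append {u l : List Bool} {x : Bool} (h : subst u = l ++ [x]) :
    u ≠ [] := by
  rintro rfl
  simp at h

/-- The nonerasing morphisms fixing the fixed point of `subst` are the powers of `subst`. -/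
theorem exists_iterate_of_stab {f g : List Bool} (hf : f ≠ []) (hg : g ≠ [])
    (h : ∀ l, IsPre l → IsPre (morph f g l)) :
    ∃ k, f = subst^[k] [false] ∧ g = subst^[k] [true] := by
  induction hn : f.length using Nat.strong_induction_on generalizing f g with
  | _ n ih =>
  subst hn
  obtain ⟨C, x, rfl⟩ := (List.eq_nil_or_concat f).resolve_left hf
  obtain ⟨X, z, rfl⟩ := (List.eq_nil_or_concat g).resolve_left hg
  simp only [List.concat_eq_append] at *
  cases x
  · obtain ⟨rfl, hX⟩ := stab_false_last hg h
    exact ⟨0, by simp [hX]⟩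
  cases z
  · exact (not_stab_true_last_false_last h).elim
  have h4 := h _ isPre_start
  simp only [morph_cons_false, morph_cons_true] at h4
  -- Both f and fg are prefixes ending in true, so both desubstitute, and hence so does g.
  obtain ⟨u, hu, -⟩ := h4.of_append.exists_eq_subst
  rw [← List.append_assoc] at h4
  have h5 := h4.of_append
  rw [← List.append_assoc] at h5
  obtain ⟨v, hv, -⟩ := h5.exists_eq_subst
  obtain ⟨w, rfl⟩ : u <+: v := prefix_of_subst_prefix (by rw [← hu, ← hv]; simp)
  rw [List.append_assoc, subst_append, ← hu] at hv
  have hw := List.append_cancel_left hv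
  have hu0 := ne_nil_of_subst_eq_append hu.symm
  have hl := length_le_length_subst u
  have h0 : 0 < u.length := List.length_pos_iff.2 hu0
  obtain ⟨k, hk1, hk2⟩ := ih u.length (by rw [hu]; omega) hu0 (ne_nil_of_subst_eq_append hw.symm)
    (fun l hl => IsPre.of_subst (by rw [subst_morph, ← hu, ← hw]; exact h l hl)) rfl
  exact ⟨k + 1, by rw [hu, hk1, Function.iterate_succ_apply'],
    by rw [hw, hk2, Function.iterate_succ_apply']⟩

/-! ### Powers of the substitution compared with their mirror images. -/

theorem subst_eq_nil {u : List Bool} : subst u = [] ↔ u = [] := by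
  constructor
  · intro h
    have := length_le_length_subst u
    rw [h] at this
    simpa using this
  · rintro rfl; rfl

/-- `V` is a prefix of a power of `subst z`; stripping whole copies leaves a prefix of `subst z`
that is empty or ends in true. -/
theorem exists_eq_subst_of_semiconj {z V Y : List Bool} (hz : z ≠ [])
    (h : subst z ++ V = V ++ Y) (hV : V = [] ∨ ∃ W, V = W ++ [true]) :
    ∃ W, V = subst W := by
  induction hn : V.length using Nat.strong_induction_on generalizing V with
  | _ n ih =>
  subst hn
  rcases hV with rfl | ⟨W, rfl⟩
  · exact ⟨[], rfl⟩
  have hp : W ++ [true] <+: subst z ++ (W ++ [true]) := ⟨Y, h.symm⟩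
  rcases List.prefix_or_prefix_of_prefix hp (List.prefix_append _ _) with h1 | ⟨V, hV⟩
  · obtain ⟨u, hu, -⟩ := eq_subst_of_prefix (r := []) (by simpa using h1) (by simp)
    exact ⟨u, hu⟩
  · have hz' : 0 < (subst z).length := List.length_pos_iff.2 (by rwa [Ne, subst_eq_nil])
    rw [← hV] at h
    obtain ⟨U, hU⟩ := ih V.length (by rw [← hV]; simp; omega)
      (by simpa using h)
      (by
        rcases List.eq_nil_or_concat V with rfl | ⟨V0, x, rfl⟩
        · exact .inl rfl
        · rw [List.concat_eq_append, ← List.append_assoc] at hV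
          have := List.append_inj_right' hV rfl
          exact .inr ⟨V0, by simpa using this⟩) rfl
    exact ⟨z ++ U, by rw [← hV, hU, subst_append]⟩

/-- The reversed images 10 and 100 are conjugate to 01 and 001 by the same letter: 10·1 = 1·01 and
100·1 = 1·001. -/
theorem reverse_subst_append (u : List Bool) :
    (subst u).reverse ++ [true] = true :: subst u.reverse := by
  induction u with
  | nil => rfl
  | cons x u ih =>
    cases x
    · simp only [subst_cons_false, List.reverse_cons, List.append_assoc, subst_append]
      rw [show [true] ++ ([false] ++ [true]) = [true] ++ [false, true] from rfl,
        ← List.append_assoc, ih]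
      rfl
    · simp only [subst_cons_true, List.reverse_cons, List.append_assoc, subst_append]
      rw [show [true] ++ ([false] ++ ([false] ++ [true])) = [true] ++ [false, false, true] from rfl,
        ← List.append_assoc, ih]
      rfl

theorem iterate_subst_ne_nil (k : ℕ) (x : Bool) : subst^[k] [x] ≠ [] := by
  induction k with
  | zero => simp
  | succ k ih => rwa [Function.iterate_succ_apply', Ne, subst_eq_nil]

/-- No proper power of `subst` is a left shift of its mirror image. -/
theorem eq_zero_of_semiconj_reverse {k : ℕ} {V : List Bool}
    (h : ∀ x, subst^[k] [x] ++ V = V ++ (subst^[k] [x]).reverse) : k = 0 ∧ V = [] := by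
  induction k generalizing V with
  | zero =>
    refine ⟨rfl, ?_⟩
    have h0 := h false
    have h1 := h true
    rcases V with _ | ⟨v, V⟩
    · rfl
    · simp at h0 h1
      simpa using h0.1.symm.trans h1.1
  | succ k ih =>
    exfalso
    simp only [Function.iterate_succ_apply'] at h
    -- Lengthening `V` by true turns the mirror image into an image under `subst`, so the relation
    -- desubstitutes; induction then makes `V ++ [true]` the image of the empty word.
    have h' : ∀ x, subst (subst^[k] [x]) ++ (V ++ [true]) =
        (V ++ [true]) ++ subst (subst^[k] [x]).reverse := by
      intro x
      rw [← List.append_assoc, h x, List.append_assoc, reverse_subst_append]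
      simp
    obtain ⟨W, hW⟩ := exists_eq_subst_of_semiconj (iterate_subst_ne_nil k true) (h' true)
      (.inr ⟨V, rfl⟩)
    rw [hW] at h'
    obtain ⟨-, rfl⟩ := ih (V := W) fun x => subst_injective (by simpa using h' x)
    simp at hW

theorem iterate_subst_succ_eq_append (k : ℕ) (x : Bool) :
    ∃ l, subst^[k + 1] [x] = l ++ [true] := by
  rcases List.eq_nil_or_concat (subst^[k + 1] [x]) with h | ⟨l, z, h⟩
  · exact (iterate_subst_ne_nil _ _ h).elim
  · rw [List.concat_eq_append] at h
    refine ⟨l, ?_⟩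
    rw [Function.iterate_succ_apply'] at h
    rw [Function.iterate_succ_apply', h, subst_eq_append_singleton h]

theorem exists_eq_subst_of_append {u A C : List Bool} {x : Bool} (hC : C ≠ [])
    (h : A ++ [x] ++ C = subst u) (hx : x = true) :
    ∃ A' C', A ++ [x] = subst A' ∧ C = subst C' ∧ A' ++ C' = u ∧ A' ≠ [] ∧ C' ≠ [] := by
  subst hx
  obtain ⟨A', hA, C', rfl⟩ := eq_subst_of_prefix (r := []) (l := A) (v := u)
    (by rw [← h]; simp) (by simp)
  rw [subst_append, hA] at h
  obtain rfl := List.append_cancel_left h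
  refine ⟨A', C', hA, rfl, rfl, ne_nil_of_subst_eq_append hA.symm, ?_⟩
  rintro rfl
  simp at hC

theorem last_eq_of_append {x : Bool} {W C l : List Bool}
    (h : W ++ (C ++ [x]) = l ++ [true]) : x = true := by
  rw [← List.append_assoc] at h
  simpa using List.append_inj_right' h rfl

/-- If the factorizations `A C`, `A B` of the images under a power of `subst` are nontrivial, then
the triple `(A, B, C)` is not a right shift of its mirror image. -/
theorem not_reverse_semiconj {k : ℕ} {A B C V : List Bool} (hA : A ≠ []) (hB : B ≠ [])
    (hC : C ≠ []) (hAC : A ++ C = subst^[k] [false]) (hAB : A ++ B = subst^[k] [true])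
    (hVA : A.reverse ++ V = V ++ A) (hVB : B.reverse ++ V = V ++ B)
    (hVC : C.reverse ++ V = V ++ C) : False := by
  induction k generalizing A B C V with
  | zero =>
    have := congrArg List.length hAC
    have := List.length_pos_iff.2 hA
    have := List.length_pos_iff.2 hC
    simp at *
    omega
  | succ k ih =>
    rcases V with _ | ⟨v, V⟩
    · simp at hVA hVB hVC
      -- Here A, B, C are palindromes, so AD·A = A·(AD)~ for D = B and D = C.
      refine absurd (eq_zero_of_semiconj_reverse (k := k + 1) (V := A) ?_).1 (by omega)
      rintro (_ | _)
      · rw [← hAC]; simp [hVA, hVC]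
      · rw [← hAB]; simp [hVA, hVB]
    · obtain ⟨A, x, rfl⟩ := (List.eq_nil_or_concat A).resolve_left hA
      obtain ⟨C, z, rfl⟩ := (List.eq_nil_or_concat C).resolve_left hC
      simp only [List.concat_eq_append] at *
      obtain ⟨l, hl⟩ := iterate_subst_succ_eq_append k false
      -- A and C both end in the first letter of the shift. Since C ends in true, so does A, and the
      -- cut after A falls between images.
      have hz : z = true := last_eq_of_append (hAC.trans hl)
      have hzv : z = v := by simp at hVC; exact hVC.1
      have hxv : x = v := by simp at hVA; exact hVA.1
      subst hxv hzv
      rw [Function.iterate_succ_apply'] at hAC hAB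
      obtain ⟨A', C', hA', hC', hAC', hA0, hC0⟩ := exists_eq_subst_of_append hC hAC hz
      obtain ⟨A'', B', hA'', hB', hAB', -, hB0⟩ := exists_eq_subst_of_append hB hAB hz
      obtain rfl : A' = A'' := subst_injective (hA'.symm.trans hA'')
      subst hz
      have key : ∀ D : List Bool, (subst D).reverse ++ true :: V = true :: V ++ subst D →
          subst D.reverse ++ V = V ++ subst D := by
        intro D hD
        rw [← List.singleton_append, ← List.append_assoc, reverse_subst_append] at hD
        simpa using hD
      rw [hA'] at hVA
      rw [hB'] at hVB
      rw [hC'] at hVC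
      have kA := key _ hVA
      have kB := key _ hVB
      have kC := key _ hVC
      obtain ⟨W, rfl⟩ := exists_eq_subst_of_semiconj (by simpa using hA0) kA (by
        rcases List.eq_nil_or_concat V with rfl | ⟨V0, x, rfl⟩
        · exact .inl rfl
        · refine .inr ⟨V0, ?_⟩
          have := congrArg List.reverse hVA
          rw [← hA'] at this
          simp at this
          simp [this.1])
      refine ih hA0 hB0 hC0 hAC' hAB' (V := W) ?_ ?_ ?_ <;> apply subst_injective <;> simpa

/-! ### Interleaving with the letter a. -/

/-- The word obtained by writing an `a` before each letter, `false` and `true` being read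
as `c` and `b`. -/
def interleave (l : List Bool) : List Letter :=
  l.flatMap fun x => [Letter.a, bif x then Letter.b else Letter.c]

@[simp] theorem interleave_nil : interleave [] = [] := rfl

@[simp] theorem interleave_cons (x : Bool) (l : List Bool) :
    interleave (x :: l) = Letter.a :: (bif x then Letter.b else Letter.c) :: interleave l := rfl

@[simp] theorem interleave_append (u v : List Bool) :
    interleave (u ++ v) = interleave u ++ interleave v :=
  List.flatMap_append

@[simp] theorem length_interleave (l : List Bool) : (interleave l).length = 2 * l.length := by
  induction l with
  | nil => rfl
  | cons x l ih => simp [ih]; omega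

theorem interleave_injective : Function.Injective interleave := by
  intro u v h
  induction u generalizing v with
  | nil => cases v <;> simp at h ⊢
  | cons x u ih =>
    cases v with
    | nil => simp at h
    | cons z v => cases x <;> cases z <;> simp at h ⊢ <;> exact ih h

theorem a_cons_reverse_interleave (l : List Bool) :
    Letter.a :: (interleave l).reverse = interleave l.reverse ++ [Letter.a] := by
  induction l with
  | nil => rfl
  | cons x l ih =>
    simp only [interleave_cons, List.reverse_cons, interleave_append, List.append_assoc]
    rw [← List.cons_append, ih]
    simp

theorem eq_interleave_of_prefix {w : List Letter} {l : List Bool} (h : w <+: interleave l) :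
    ∃ u, w = interleave u ∧ u <+: l ∨ w = interleave u ++ [Letter.a] := by
  induction l generalizing w with
  | nil => exact ⟨[], .inl ⟨by simpa using h, by simp⟩⟩
  | cons x l ih =>
    rcases w with _ | ⟨w0, _ | ⟨w1, w⟩⟩
    · exact ⟨[], .inl ⟨rfl, by simp⟩⟩
    · exact ⟨[], .inr (by simpa [List.cons_prefix_cons] using h)⟩
    · simp [List.cons_prefix_cons] at h
      obtain ⟨rfl, rfl, h⟩ := h
      obtain ⟨u, ⟨rfl, hu⟩ | rfl⟩ := ih h
      · exact ⟨x :: u, .inl ⟨rfl, by simpa [List.cons_prefix_cons]⟩⟩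
      · exact ⟨x :: u, .inr rfl⟩

theorem eq_interleave_of_semiconj {Z : List Bool} {V Y : List Letter} (hZ : Z ≠ [])
    (h : interleave Z ++ V = V ++ Y) :
    ∃ W, V = interleave W ∨ V = interleave W ++ [Letter.a] := by
  induction hn : V.length using Nat.strong_induction_on generalizing V with
  | _ n ih =>
  subst hn
  have hp : V <+: interleave Z ++ V := ⟨Y, h.symm⟩
  rcases List.prefix_or_prefix_of_prefix hp (List.prefix_append _ _) with h1 | ⟨U, rfl⟩
  · obtain ⟨u, ⟨h, -⟩ | h⟩ := eq_interleave_of_prefix h1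
    exacts [⟨u, .inl h⟩, ⟨u, .inr h⟩]
  · have := List.length_pos_iff.2 hZ
    obtain ⟨W, rfl | rfl⟩ := ih U.length (by simp; omega)
      (by simpa using h) rfl
    · exact ⟨Z ++ W, .inl (by simp)⟩
    · exact ⟨Z ++ W, .inr (by simp)⟩

/-! ### Conjugates in class P over any alphabet. -/

theorem reverse_mul_of_classP {A : Type*} {p q : List A} (hp : p.reverse = p)
    (hq : q.reverse = q) : (p ++ q) ++ p = p ++ (p ++ q).reverse := by
  simp [hp, hq]

/-- Both words are prefixes of the periodic word uuu⋯. -/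
theorem prefix_or_prefix_of_semiconj {A : Type*} {u w p y z : List A} (hu : u ≠ [])
    (hw : u ++ w = w ++ y) (hp : u ++ p = p ++ z) : w <+: p ∨ p <+: w := by
  induction hn : w.length using Nat.strong_induction_on generalizing w p with
  | _ n ih =>
  subst hn
  rcases List.prefix_or_prefix_of_prefix (⟨y, hw.symm⟩ : w <+: u ++ w)
    (List.prefix_append _ _) with hwu | ⟨w', rfl⟩
  · exact List.prefix_or_prefix_of_prefix (hwu.trans (List.prefix_append _ _)) ⟨z, hp.symm⟩
  rcases List.prefix_or_prefix_of_prefix (⟨z, hp.symm⟩ : p <+: u ++ p)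
    (List.prefix_append _ _) with hpu | ⟨p', rfl⟩
  · exact .inr (hpu.trans (List.prefix_append _ _))
  have := List.length_pos_iff.2 hu
  simpa [List.prefix_append_right_inj] using
    ih w'.length (by simp; omega) (by simpa using hw) (by simpa using hp) rfl

/-- A morphism with a conjugate in class P is a left or a right shift of its mirror image, and the
length of the shift has the parity of the palindrome `p`. -/
theorem exists_semiconj_reverse {A : Type*} {Φ Ψ : A → List A} {p w : List A} (hp : p.reverse = p)
    (hΨ : ∀ α, Ψ α ++ p = p ++ (Ψ α).reverse) (hne : ∃ α, Ψ α ≠ [])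
    (h : (∀ α, Φ α ++ w = w ++ Ψ α) ∨ ∀ α, Ψ α ++ w = w ++ Φ α) :
    ∃ V : List A, V.length % 2 = p.length % 2 ∧
      ((∀ α, Φ α ++ V = V ++ (Φ α).reverse) ∨ ∀ α, (Φ α).reverse ++ V = V ++ Φ α) := by
  rcases h with h | h
  · refine ⟨w ++ (p ++ w.reverse), by simp; omega, .inl fun α => ?_⟩
    have h' := congrArg List.reverse (h α)
    simp only [List.reverse_append] at h'
    calc Φ α ++ (w ++ (p ++ w.reverse)) = (Φ α ++ w) ++ (p ++ w.reverse) := by simp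
      _ = w ++ (Ψ α ++ p) ++ w.reverse := by rw [h]; simp
      _ = w ++ p ++ ((Ψ α).reverse ++ w.reverse) := by rw [hΨ]; simp
      _ = _ := by rw [← h']; simp
  · have h' : ∀ α, (Φ α).reverse ++ w.reverse = w.reverse ++ (Ψ α).reverse := fun α => by
      simpa using (congrArg List.reverse (h α)).symm
    obtain ⟨α₀, hα₀⟩ := hne
    rcases prefix_or_prefix_of_semiconj hα₀ (h α₀) (hΨ α₀) with ⟨p1, h1⟩ | ⟨w1, h1⟩
    -- Both w~ and p1 are suffixes of p = w p1: either p = w p2 w~, and p2 is the shift, or w~ = w2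
    -- p1, and w2 is the shift in the opposite direction.
    · have hs : w.reverse <:+ p := ⟨p1.reverse, by rw [← List.reverse_append, h1, hp]⟩
      rcases List.suffix_or_suffix_of_suffix hs ⟨w, h1⟩ with ⟨p2, rfl⟩ | ⟨w2, h2⟩
      · refine ⟨p2, by rw [← h1]; simp; omega, .inl fun α => ?_⟩
        apply List.append_cancel_left (as := w)
        apply List.append_cancel_right (bs := w.reverse)
        calc w ++ (Φ α ++ p2) ++ w.reverse = (w ++ Φ α) ++ (p2 ++ w.reverse) := by simp
          _ = Ψ α ++ p := by rw [← h, ← h1]; simp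
          _ = (w ++ p2) ++ (w.reverse ++ (Ψ α).reverse) := by rw [hΨ, ← h1]; simp
          _ = _ := by rw [← h']; simp
      · have h3 : ∀ α, p1 ++ (Ψ α).reverse = Φ α ++ p1 := fun α => by
          apply List.append_cancel_left (as := w)
          rw [← List.append_assoc, h1, ← hΨ, ← List.append_assoc, ← h, List.append_assoc, h1]
        refine ⟨w2, ?_, .inr fun α => ?_⟩
        · have e1 := congrArg List.length h1
          have e2 := congrArg List.length h2
          simp at e1 e2
          omega
        · apply List.append_cancel_right (bs := p1)
          rw [List.append_assoc, h2, h', ← h2, List.append_assoc, h3, List.append_assoc]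
    · have hw : w.reverse = w1.reverse ++ p := by rw [← h1]; simp [hp]
      refine ⟨w1.reverse ++ (p ++ w1), by simp; omega, .inr fun α => ?_⟩
      have h3 : (Ψ α).reverse ++ w1 = w1 ++ Φ α := by
        apply List.append_cancel_left (as := p)
        rw [← List.append_assoc, ← hΨ, List.append_assoc, h1, h, ← h1, List.append_assoc]
      calc (Φ α).reverse ++ (w1.reverse ++ (p ++ w1)) = ((Φ α).reverse ++ w.reverse) ++ w1 := by
            rw [hw]; simp
        _ = w1.reverse ++ p ++ ((Ψ α).reverse ++ w1) := by rw [h', hw]; simp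
        _ = _ := by rw [h3]; simp

/-! ### No conjugate in class P: transfer to three letters. -/

theorem interleave_eq_append_singleton {l : List Bool} {w : List Letter} {x : Letter}
    (h : interleave l = w ++ [x]) : x ≠ Letter.a := by
  rcases List.eq_nil_or_concat l with rfl | ⟨l', z, rfl⟩
  · simp at h
  · have := congrArg List.getLast? h
    rintro rfl
    cases z <;> simp at this

/-- The right side ends in a, which no interleaving does; so `V` cannot be an interleaving and must
end in an extra a. -/
theorem interleave_semiconj_reverse {Z : List Bool} {V : List Letter} (hZ : Z ≠ [])
    (h : interleave Z ++ V = V ++ (interleave Z).reverse) :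
    ∃ W, V = interleave W ++ [Letter.a] ∧ Z ++ W = W ++ Z.reverse := by
  obtain ⟨W, rfl | rfl⟩ := eq_interleave_of_semiconj hZ h
  · obtain ⟨z, Z, rfl⟩ := List.exists_cons_of_ne_nil hZ
    rw [← interleave_append] at h
    exact absurd rfl (interleave_eq_append_singleton (x := Letter.a)
      (w := interleave W ++ ((interleave Z).reverse ++ [bif z then Letter.b else Letter.c]))
      (by rw [h]; simp))
  · refine ⟨W, rfl, interleave_injective ?_⟩
    apply List.append_cancel_right (bs := [Letter.a])
    rw [interleave_append, interleave_append, List.append_assoc, h, List.append_assoc,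
      List.append_assoc, List.singleton_append, a_cons_reverse_interleave]

/-- Prefixing an a makes the mirror image an interleaving again, up to a shift by one letter. It
follows that `V` has odd length. -/
theorem interleave_reverse_semiconj {Z : List Bool} {V : List Letter} (hZ : Z ≠ [])
    (h : (interleave Z).reverse ++ V = V ++ interleave Z) :
    ∃ W, Letter.a :: V = interleave W ∧ Z.reverse ++ W = W ++ Z := by
  have h' : interleave Z.reverse ++ (Letter.a :: V) = (Letter.a :: V) ++ interleave Z := by
    rw [List.cons_append, ← h, ← List.cons_append, a_cons_reverse_interleave]
    simp
  obtain ⟨W, hW | hW⟩ := eq_interleave_of_semiconj (by simpa using hZ) h'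
  · refine ⟨W, hW, interleave_injective ?_⟩
    simpa [hW] using h'
  · obtain ⟨z, Z, rfl⟩ := List.exists_cons_of_ne_nil hZ
    exfalso
    rw [hW] at h'
    have h2 : interleave W ++ [Letter.a] ++ [Letter.a] <+:
        interleave ((z :: Z).reverse ++ W ++ [z]) := by
      rw [List.append_assoc, interleave_append, interleave_append, List.append_assoc]
      have : interleave (z :: Z).reverse ++ (interleave W ++ interleave [z]) =
        interleave (z :: Z).reverse ++ (interleave W ++ [Letter.a]) ++
          [bif z then Letter.b else Letter.c] := by simp
      rw [this, h']
      simp [List.prefix_append_right_inj, List.cons_prefix_cons]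
    obtain ⟨u, ⟨hu, -⟩ | hu⟩ := eq_interleave_of_prefix h2
    · exact interleave_eq_append_singleton hu.symm rfl
    · have := List.append_inj_left' hu rfl
      exact interleave_eq_append_singleton this.symm rfl

theorem exists_eq_interleave_append {P Q : List Letter} {u : List Bool}
    (h : P ++ Q = interleave u) (hP : ¬ [Letter.a] <:+ P) :
    ∃ P' Q', P = interleave P' ∧ Q = interleave Q' ∧ P' ++ Q' = u := by
  obtain ⟨P', ⟨rfl, Q', rfl⟩ | rfl⟩ := eq_interleave_of_prefix (w := P) (l := u) ⟨Q, h⟩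
  · exact ⟨P', Q', rfl, by simpa using h, rfl⟩
  · exact absurd (List.suffix_append _ _) hP

/-- The letter `b` or `c`. -/
def boolLetter (x : Bool) : Letter := bif x then Letter.b else Letter.c

theorem last_eq_b {k : ℕ} {x : Bool} {P Q : List Letter} {y : Letter}
    (h : P ++ (Q ++ [y]) = interleave (subst^[k + 1] [x])) : y = Letter.b := by
  obtain ⟨l, hl⟩ := iterate_subst_succ_eq_append k x
  rw [hl, ← List.append_assoc] at h
  have := congrArg List.getLast? h
  simpa using this

/-- Prepending `Φ a` to `V` gives a single shift for both products, which reduces the claim to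
`eq_zero_of_semiconj_reverse`. -/
theorem not_semiconj_reverse_of_factor {k : ℕ} {Φ : Letter → List Letter} {V : List Letter}
    (hΦ : ∀ x, Φ Letter.a ++ Φ (boolLetter x) = interleave (subst^[k + 1] [x]))
    (h : ∀ α, Φ α ++ V = V ++ (Φ α).reverse) : False := by
  have key : ∀ x, interleave (subst^[k + 1] [x]) ++ (Φ Letter.a ++ V) =
      (Φ Letter.a ++ V) ++ (interleave (subst^[k + 1] [x])).reverse := fun x => by
    rw [← hΦ x, h Letter.a]
    calc Φ Letter.a ++ Φ (boolLetter x) ++ (V ++ (Φ Letter.a).reverse)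
        = Φ Letter.a ++ (Φ (boolLetter x) ++ V) ++ (Φ Letter.a).reverse := by simp
      _ = (Φ Letter.a ++ V) ++ ((Φ (boolLetter x)).reverse ++ (Φ Letter.a).reverse) := by
          rw [h]; simp
      _ = _ := by rw [h]; simp
  obtain ⟨W, hW, -⟩ := interleave_semiconj_reverse (iterate_subst_ne_nil _ _) (key false)
  refine absurd (eq_zero_of_semiconj_reverse (k := k + 1) (V := W) fun x => ?_).1 (by omega)
  obtain ⟨W', hW', h'⟩ := interleave_semiconj_reverse (iterate_subst_ne_nil _ _) (key x)
  obtain rfl : W = W' :=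
    interleave_injective (List.append_inj_left' (hW.symm.trans hW') rfl)
  exact h'

/-- The surviving case is later excluded by parity: in class P an empty image forces an empty p,
hence a `V` of even length. -/
theorem reverse_semiconj_of_factor {k : ℕ} {Φ : Letter → List Letter} {V : List Letter}
    (hΦ : ∀ x, Φ Letter.a ++ Φ (boolLetter x) = interleave (subst^[k + 1] [x]))
    (h : ∀ α, (Φ α).reverse ++ V = V ++ Φ α) : V.length % 2 = 1 ∧ ∃ α, Φ α = [] := by
  rcases V with _ | ⟨v, V⟩
  · exact (not_semiconj_reverse_of_factor hΦ (V := []) fun α => by simpa using (h α).symm).elim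
  have hlast : ∀ α P y, Φ α = P ++ [y] → y = v := fun α P y hy => by
    have := h α
    rw [hy] at this
    simp at this
    exact this.1
  have hodd : ∀ Z : List Bool, Z ≠ [] →
      (interleave Z).reverse ++ v :: V = v :: V ++ interleave Z → (v :: V).length % 2 = 1 :=
    fun Z hZ h => by
      obtain ⟨W, hW, -⟩ := interleave_reverse_semiconj hZ h
      have := congrArg List.length hW
      simp at this ⊢
      omega
  by_cases hC : Φ Letter.c = []
  · refine ⟨hodd (subst^[k + 1] [false]) (iterate_subst_ne_nil _ _) ?_, _, hC⟩
    rw [← hΦ false]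
    simpa [boolLetter, hC] using h Letter.a
  by_cases hB : Φ Letter.b = []
  · refine ⟨hodd (subst^[k + 1] [true]) (iterate_subst_ne_nil _ _) ?_, _, hB⟩
    rw [← hΦ true]
    simpa [boolLetter, hB] using h Letter.a
  -- Nonempty images all end in the first letter of `V`, which is b because `Φ c` ends in b. So `Φ
  -- a` does not end in a, and the cuts respect the interleaving.
  obtain ⟨C, y, hCy⟩ := (List.eq_nil_or_concat _).resolve_left hC
  rw [List.concat_eq_append] at hCy
  have hy : y = Letter.b := last_eq_b (by rw [← hCy]; exact hΦ false)
  obtain rfl : y = v := hlast _ _ _ hCy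
  have hA : ¬ [Letter.a] <:+ Φ Letter.a := by
    rintro ⟨P, hP⟩
    have := hlast _ _ _ hP.symm
    rw [hy] at this
    cases this
  obtain ⟨A, C, eA, eC, hAC⟩ := exists_eq_interleave_append (hΦ false) hA
  obtain ⟨A', B, eA', eB, hAB⟩ := exists_eq_interleave_append (hΦ true) hA
  obtain rfl := interleave_injective (eA.symm.trans eA')
  simp only [boolLetter, cond_true, cond_false] at eB eC
  have hC0 : C ≠ [] := by rintro rfl; exact hC eC
  have hB0 : B ≠ [] := by rintro rfl; exact hB eB
  have kC := h Letter.c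
  have kB := h Letter.b
  have kA := h Letter.a
  rw [eC] at kC
  rw [eB] at kB
  rw [eA] at kA
  refine ⟨hodd C hC0 kC, Letter.a, ?_⟩
  by_contra hA1
  have hA0 : A ≠ [] := by rintro rfl; exact hA1 eA
  obtain ⟨W, hW, wA⟩ := interleave_reverse_semiconj hA0 kA
  obtain ⟨W', hW', wB⟩ := interleave_reverse_semiconj hB0 kB
  obtain rfl := interleave_injective (hW.symm.trans hW')
  obtain ⟨W', hW', wC⟩ := interleave_reverse_semiconj hC0 kC
  obtain rfl := interleave_injective (hW.symm.trans hW')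
  exact not_reverse_semiconj hA0 hB0 hC0 hAC hAB wA wB wC

theorem toList_apply {A : Type*} (φ : Morphism A) (w : FreeMonoid A) :
    (φ w).toList = w.toList.flatMap fun α => (φ (FreeMonoid.of α)).toList := by
  induction w using FreeMonoid.inductionOn' with
  | one => simp
  | of_mul α w ih => simp [ih]

theorem not_hasConjugateInClassP {φ : Morphism Letter} {k : ℕ} (hφ1 : φ ≠ 1)
    (hφ : ∀ x, (φ (FreeMonoid.of Letter.a)).toList ++ (φ (FreeMonoid.of (boolLetter x))).toList =
      interleave (subst^[k] [x])) : ¬ HasConjugateInClassP φ := by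
  rintro ⟨ψ, hconj, p, hp, hψ⟩
  set Φ : Letter → List Letter := fun α => (φ (FreeMonoid.of α)).toList with hΦ
  set Ψ : Letter → List Letter := fun α => (ψ (FreeMonoid.of α)).toList with hΨ
  obtain ⟨w, h⟩ : ∃ w : List Letter,
      (∀ α, Φ α ++ w = w ++ Ψ α) ∨ ∀ α, Ψ α ++ w = w ++ Φ α := by
    rcases hconj with ⟨w, hw⟩ | ⟨w, hw⟩
    · exact ⟨w.toList, .inl fun α => congrArg FreeMonoid.toList (hw (FreeMonoid.of α))⟩
    · exact ⟨w.toList, .inr fun α => congrArg FreeMonoid.toList (hw (FreeMonoid.of α))⟩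
  have hlen : ∀ α, (Φ α).length = (Ψ α).length := fun α => by
    rcases h with h | h
    all_goals
      have := congrArg List.length (h α)
      simp at this
      omega
  have hpal : ∀ α, Ψ α ++ p.toList = p.toList ++ (Ψ α).reverse := fun α => by
    obtain ⟨q, hq, e⟩ := hψ α
    have : Ψ α = p.toList ++ q.toList := by simp [hΨ, e]
    rw [this]
    exact reverse_mul_of_classP hp hq
  have hple : ∀ α, p.toList.length ≤ (Φ α).length := fun α => by
    obtain ⟨q, hq, e⟩ := hψ α
    rw [hlen]
    simp [hΨ, e]
  have hne : ∃ α, Ψ α ≠ [] := by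
    by_contra! hall
    have := congrArg List.length (hφ true)
    have h0 := List.length_pos_iff.2 (iterate_subst_ne_nil k true)
    change (Φ _ ++ Φ _).length = _ at this
    rw [List.length_append, hlen, hlen, hall, hall] at this
    simp only [List.length_nil, length_interleave] at this
    omega
  obtain ⟨V, hV, h'⟩ := exists_semiconj_reverse hp hpal hne h
  change ∀ x, Φ Letter.a ++ Φ (boolLetter x) = _ at hφ
  rcases k with _ | k
  · have hc := hφ false
    have hb := hφ true
    simp [boolLetter] at hc hb
    rcases hA : Φ Letter.a with _ | ⟨x, _ | ⟨z, A⟩⟩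
    -- An empty `Φ a` forces p to be empty and |V| even. Parity is needed: for `Φ c` = ac and `Φ b`
    -- = ab, the word V = a satisfies the first relation.
    · have hp0 := hple Letter.a
      rw [hA] at hc hb hp0
      simp at hc hb hp0
      rw [hp0] at hV
      rcases h' with h' | h'
      · have h1 := h' Letter.c
        have h2 := h' Letter.b
        rw [hc] at h1
        rw [hb] at h2
        rcases V with _ | ⟨v0, _ | ⟨v1, V⟩⟩
        · simp at h1
        · simp at hV
        · simp at h1 h2
          have := h1.2.1.trans h2.2.1.symm
          cases this
      · have h1 := h' Letter.c
        have h2 := h' Letter.b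
        rw [hc] at h1
        rw [hb] at h2
        rcases V with _ | ⟨v0, V⟩
        · simp at h1
        · simp at h1 h2
          have := h1.1.trans h2.1.symm
          cases this
    · rw [hA] at hc hb
      simp at hc hb
      apply hφ1
      refine FreeMonoid.hom_eq fun α => FreeMonoid.toList.injective ?_
      cases α
      · exact hA.trans (by rw [hc.1]; rfl)
      · exact hb.2
      · exact hc.2
    · rw [hA] at hc hb
      simp at hc hb
      have := hc.2.1.symm.trans hb.2.1
      cases this
  · rcases h' with h' | h'
    · exact not_semiconj_reverse_of_factor hφ h'
    · obtain ⟨hodd, α, hα⟩ := reverse_semiconj_of_factor hφ h'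
      have := hple α
      rw [hα] at this
      simp at this
      simp [this] at hV
      omega

/-! ### The ternary fixed point and its uniqueness. -/

theorem interleave_append_a_prefix {u v : List Bool} (h : u <+: v) :
    interleave u ++ [Letter.a] <+: interleave v ++ [Letter.a] := by
  obtain ⟨t, rfl⟩ := h
  cases t <;> simp [List.prefix_append_right_inj, List.cons_prefix_cons]

/-- The last a contributes aca, which accounts for the false appended in `pref`. -/
theorem gamma_interleave (l : List Bool) :
    ((interleave l ++ [Letter.a]).flatMap fun α => (gamma (FreeMonoid.of α)).toList) =
      interleave (subst l ++ [false]) ++ [Letter.a] := by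
  induction l with
  | nil => rfl
  | cons x l ih =>
    cases x <;> simp only [interleave_cons, List.cons_append, List.flatMap_cons, ih] <;> rfl

theorem toList_gamma_pow (n : ℕ) :
    ((gamma ^ n) (FreeMonoid.of Letter.a)).toList = interleave (pref n) ++ [Letter.a] := by
  induction n with
  | zero => rfl
  | succ n ih =>
    rw [pow_succ', Monoid.End.coe_mul, Function.comp_apply, toList_apply, ih, gamma_interleave]
    rfl

/-- `w` is a prefix of the fixed point of `gamma`. -/
def IsXPre (w : List Letter) : Prop := ∃ n, w <+: interleave (pref n) ++ [Letter.a]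

theorem le_length_pref (n : ℕ) : n ≤ (pref n).length := by
  induction n with
  | zero => simp
  | succ n ih =>
    have := length_le_length_subst (pref n)
    simp [pref]
    omega

theorem toList_factorAt {A : Type*} (x : ℕ → A) (m n : ℕ) :
    (factorAt x m n).toList = (List.range n).map fun i => x (m + i) := rfl

theorem eq_factorAt_of_prefix {A : Type*} {x : ℕ → A} {w l : List A} (h : w <+: l)
    (hl : l = (factorAt x 0 l.length).toList) : w = (factorAt x 0 w.length).toList := by
  obtain ⟨t, rfl⟩ := h
  have := congrArg (List.take w.length) hl
  simpa [toList_factorAt, ← List.map_take, List.take_range] using this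

theorem factorAt_prefix {A : Type*} (x : ℕ → A) {m n : ℕ} (h : m ≤ n) :
    (factorAt x 0 m).toList <+: (factorAt x 0 n).toList := by
  obtain ⟨k, rfl⟩ := Nat.exists_eq_add_of_le h
  simp [toList_factorAt, List.range_add]

theorem eq_xGamma_of_prefixes {y : ℕ → Letter}
    (h : ∀ n, ((gamma ^ n) (FreeMonoid.of Letter.a)).toList =
      (factorAt y 0 ((gamma ^ n) (FreeMonoid.of Letter.a)).toList.length).toList) :
    y = xGamma := by
  funext n
  have hn : n < ((gamma ^ n) (FreeMonoid.of Letter.a)).toList.length := by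
    have := le_length_pref n
    rw [toList_gamma_pow]
    simp
    omega
  rw [xGamma, List.getD_eq_getElem _ _ hn]
  have := List.getElem_of_eq (h n) hn
  rw [this]
  simp [toList_factorAt]

theorem exists_factorAt_of_prefixes {A : Type*} {P : ℕ → List A} (d : A)
    (hP : ∀ n, P n <+: P (n + 1)) (hlen : ∀ n, n < (P n).length) (n : ℕ) :
    P n = (factorAt (fun i => (P i).getD i d) 0 (P n).length).toList := by
  have hmono : ∀ {m n}, m ≤ n → P m <+: P n := fun {m n} h => by
    induction h with
    | refl => exact List.prefix_rfl
    | step _ ih => exact ih.trans (hP _)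
  refine List.ext_getElem (by simp [toList_factorAt]) fun i h1 h2 => ?_
  simp only [toList_factorAt, List.getElem_map, List.getElem_range, zero_add]
  rw [List.getD_eq_getElem _ _ (hlen i)]
  rcases le_total i n with h | h
  · exact ((hmono h).getElem _).symm
  · exact (hmono h).getElem _

theorem interleave_pref_eq_factorAt (n : ℕ) : interleave (pref n) ++ [Letter.a] =
    (factorAt xGamma 0 (interleave (pref n) ++ [Letter.a]).length).toList := by
  have : xGamma = fun i => (interleave (pref i) ++ [Letter.a]).getD i Letter.a :=
    funext fun i => by rw [xGamma, toList_gamma_pow]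
  rw [this]
  refine exists_factorAt_of_prefixes (P := fun i => interleave (pref i) ++ [Letter.a]) _
    (fun n => interleave_append_a_prefix (pref_prefix_succ n)) (fun n => ?_) n
  have := le_length_pref n
  simp
  omega

theorem IsXPre.eq_factorAt {w : List Letter} (h : IsXPre w) :
    w = (factorAt xGamma 0 w.length).toList :=
  let ⟨n, hn⟩ := h
  eq_factorAt_of_prefix hn (interleave_pref_eq_factorAt n)

theorem isXPre_factorAt (m : ℕ) : IsXPre (factorAt xGamma 0 m).toList := by
  refine ⟨m, ?_⟩
  rw [interleave_pref_eq_factorAt]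
  apply factorAt_prefix
  have := le_length_pref m
  simp
  omega

theorem xGamma_zero : xGamma 0 = Letter.a := rfl

theorem IsXPre.gamma {w : List Letter} (h : IsXPre w) :
    IsXPre (w.flatMap fun α => (HKS.gamma (FreeMonoid.of α)).toList) := by
  obtain ⟨n, t, ht⟩ := h
  refine ⟨n + 1, ?_⟩
  rw [pref, ← gamma_interleave, ← ht, List.flatMap_append]
  exact List.prefix_append _ _

theorem mapsTo_gamma : MapsTo gamma xGamma xGamma := by
  constructor
  · intro n
    apply FreeMonoid.toList.injective
    rw [toList_apply]
    have := (isXPre_factorAt n).gamma.eq_factorAt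
    rw [← toList_apply] at this ⊢
    exact this
  · intro m
    refine ⟨(interleave (pref m) ++ [Letter.a]).length, ?_⟩
    change _ ≤ (FreeMonoid.toList (gamma _)).length
    rw [toList_apply, ← interleave_pref_eq_factorAt, gamma_interleave]
    have := le_length_pref (m + 1)
    rw [pref] at this
    rw [List.length_append, length_interleave]
    omega

theorem eq_xGamma {y : ℕ → Letter} (h0 : y 0 = Letter.a) (h : MapsTo gamma y y) :
    y = xGamma := by
  refine eq_xGamma_of_prefixes fun n => ?_
  induction n with
  | zero => simp [toList_factorAt, List.range_succ, h0]
  | succ n ih =>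
    have := congrArg FreeMonoid.toList (h.1 ((gamma ^ n) (FreeMonoid.of Letter.a)).toList.length)
    rw [toList_apply, ← ih, ← toList_apply] at this
    rw [pow_succ', Monoid.End.coe_mul, Function.comp_apply]
    convert this using 2
    congr 1
    change _ = (FreeMonoid.toList _).length
    rw [toList_apply gamma (factorAt _ _ _), ← ih, ← toList_apply]

theorem isPrimitive_gamma : IsPrimitive gamma := by
  refine ⟨3, fun α β => ?_⟩
  have ha : ((gamma ^ 3) (FreeMonoid.of Letter.a)).toList =
    [.a, .c, .a, .b, .a, .c, .a, .c, .a, .b, .a, .c, .a, .b, .a, .c, .a] := rfl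
  have hb : ((gamma ^ 3) (FreeMonoid.of Letter.b)).toList =
    [.c, .a, .b, .a, .c, .a, .b, .a, .c, .a, .b, .a, .c, .a, .c, .a, .b] := rfl
  have hc : ((gamma ^ 3) (FreeMonoid.of Letter.c)).toList = [.b, .a, .c, .a, .c, .a, .b] := rfl
  cases α
  · rw [ha]; cases β <;> simp
  · rw [hb]; cases β <;> simp
  · rw [hc]; cases β <;> simp

/-! ### Palindromic factors. -/

theorem exists_palindrome (n : ℕ) : ∃ s u : List Bool, s ≠ [] ∧ IsPre (s ++ u) ∧
    u.reverse = u ∧ n < u.length := by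
  induction n with
  | zero => exact ⟨[false], [true], by simp, isPre_start.of_prefix (by decide), rfl, by simp⟩
  | succ n ih =>
    obtain ⟨s, u, hs, hp, hu, hn⟩ := ih
    -- As `s` is nonempty, `subst s` supplies the true that completes `subst u` to a palindrome.
    obtain ⟨l, x, hl⟩ := (List.eq_nil_or_concat (subst s)).resolve_left (by rwa [subst_eq_nil])
    rw [List.concat_eq_append] at hl
    obtain rfl := subst_eq_append_singleton hl
    have hlen := length_le_length_subst u
    refine ⟨l, true :: subst u, ?_, ?_, ?_, by simp; omega⟩
    · rintro rfl
      have h1 := length_le_length_subst s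
      have h2 := List.length_pos_iff.2 hs
      rw [hl] at h1
      simp at h1
      omega
    · have := hp.subst
      rw [subst_append, hl] at this
      simpa using this
    · rw [List.reverse_cons, reverse_subst_append, hu]

theorem isPalindromic_xGamma : IsPalindromic xGamma := by
  intro n
  obtain ⟨s, u, -, ⟨m, hm⟩, hu, hn⟩ := exists_palindrome n
  have hX : IsXPre (interleave (s ++ u) ++ [Letter.a]) := ⟨m, interleave_append_a_prefix hm⟩
  have hfac := congrArg (List.drop (interleave s).length) hX.eq_factorAt
  refine ⟨FreeMonoid.ofList (interleave u ++ [Letter.a]),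
    ⟨(interleave s).length, 2 * u.length + 1, ?_⟩, ?_, ?_⟩
  · apply FreeMonoid.toList.injective
    rw [interleave_append, List.append_assoc, List.drop_left] at hfac
    refine hfac.trans ?_
    rw [show (interleave s ++ (interleave u ++ [Letter.a])).length =
      (interleave s).length + (2 * u.length + 1) by simp]
    rw [toList_factorAt, List.range_add, List.map_append, List.drop_left' (by simp)]
    simp [toList_factorAt, Function.comp_def]
  · change (interleave u ++ [Letter.a]).reverse = interleave u ++ [Letter.a]
    rw [List.reverse_append, List.reverse_singleton, List.singleton_append,
      a_cons_reverse_interleave, hu]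
  · change n ≤ (interleave u ++ [Letter.a]).length
    simp
    omega

/-! ### The stabilizer of the ternary fixed point. -/

theorem IsXPre.of_append {w r : List Letter} (h : IsXPre (w ++ r)) : IsXPre w :=
  let ⟨n, hn⟩ := h
  ⟨n, (List.prefix_append _ _).trans hn⟩

theorem IsXPre.exists_prefix_interleave {w : List Letter} (h : IsXPre w) :
    ∃ n, w <+: interleave (pref n) := by
  obtain ⟨n, hn⟩ := h
  refine ⟨n + 1, hn.trans ?_⟩
  obtain ⟨t, ht⟩ := pref_prefix_succ n
  have : t ≠ [] := by
    rintro rfl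
    have h1 := congrArg List.length ht
    have h2 := length_le_length_subst (pref n)
    simp [pref] at h1
    omega
  obtain ⟨x, t, rfl⟩ := List.exists_cons_of_ne_nil this
  rw [← ht]
  simp [List.prefix_append_right_inj, List.cons_prefix_cons]

theorem IsPre.isXPre {l : List Bool} (h : IsPre l) : IsXPre (interleave l) :=
  let ⟨n, hn⟩ := h
  ⟨n, (List.prefix_append _ _).trans (interleave_append_a_prefix hn)⟩

theorem isPre_of_isXPre {l : List Bool} (h : IsXPre (interleave l)) : IsPre l := by
  obtain ⟨n, hn⟩ := h.exists_prefix_interleave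
  obtain ⟨u, ⟨hu, h⟩ | hu⟩ := eq_interleave_of_prefix hn
  · rw [interleave_injective hu]
    exact ⟨n, h⟩
  · exact absurd rfl (interleave_eq_append_singleton hu)

theorem IsXPre.exists_eq_interleave {s r : List Letter} (h : IsXPre (s ++ Letter.a :: r)) :
    ∃ u, s = interleave u := by
  have h' : IsXPre (s ++ [Letter.a]) := IsXPre.of_append (r := r) (by simpa using h)
  obtain ⟨n, hn⟩ := h'.exists_prefix_interleave
  obtain ⟨u, ⟨hu, -⟩ | hu⟩ := eq_interleave_of_prefix hn
  · exact absurd rfl (interleave_eq_append_singleton hu.symm)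
  · exact ⟨u, List.append_inj_left' hu rfl⟩

theorem IsXPre.head_eq {x : Letter} {l : List Letter} (h : IsXPre (x :: l)) : x = Letter.a := by
  obtain ⟨n, hn⟩ := h.exists_prefix_interleave
  cases hp : pref n <;> rw [hp] at hn <;> simp [List.cons_prefix_cons] at hn
  exact hn.1

theorem eq_interleave_of_append {p u : List Bool} {g : List Letter}
    (h : interleave p ++ g = interleave u) : ∃ q, g = interleave q := by
  obtain ⟨p', q, -, hq, -⟩ := exists_eq_interleave_append h (by
    rintro ⟨t, ht⟩
    exact interleave_eq_append_singleton ht.symm rfl)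
  exact ⟨q, hq⟩

theorem count_true_subst (l : List Bool) : (subst l).count true = l.length := by
  induction l with
  | nil => rfl
  | cons x l ih => cases x <;> simp [ih]

theorem length_le_count_false_subst (l : List Bool) : l.length ≤ (subst l).count false := by
  induction l with
  | nil => simp
  | cons x l ih => cases x <;> simp <;> omega

theorem exists_isPre_le_count (x : Bool) (n : ℕ) : ∃ l, IsPre l ∧ n ≤ l.count x := by
  refine ⟨subst (pref n), IsPre.subst ⟨n, List.prefix_rfl⟩, (le_length_pref n).trans ?_⟩
  cases x
  · exact length_le_count_false_subst _
  · exact (count_true_subst _).ge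

theorem replicate_flatten_prefix {A : Type*} {m n : ℕ} (h : m ≤ n) (f : List A) :
    (List.replicate m f).flatten <+: (List.replicate n f).flatten := by
  obtain ⟨k, rfl⟩ := Nat.exists_eq_add_of_le h
  rw [List.replicate_add, List.flatten_append]
  exact List.prefix_append _ _

theorem morph_nil_left (g l : List Bool) :
    morph [] g l = (List.replicate (l.count true) g).flatten := by
  induction l with
  | nil => rfl
  | cons x l ih => cases x <;> simp [ih, List.replicate_succ]

theorem morph_nil_right (f l : List Bool) :
    morph f [] l = (List.replicate (l.count false) f).flatten := by
  induction l with
  | nil => rfl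
  | cons x l ih => cases x <;> simp [ih, List.replicate_succ]

/-- If one image were empty, all powers of the other would be prefixes, against aperiodicity. -/
theorem ne_nil_of_morph {f g : List Bool} (h : ∀ l, IsPre l → IsPre (morph f g l))
    (hne : ¬ (f = [] ∧ g = [])) : f ≠ [] ∧ g ≠ [] := by
  constructor <;> rintro rfl <;> refine hne ?_
  · refine ⟨rfl, eq_nil_of_forall_isPre_replicate fun n => ?_⟩
    obtain ⟨l, hl, hn⟩ := exists_isPre_le_count true n
    exact (morph_nil_left g l ▸ h l hl).of_prefix (replicate_flatten_prefix hn g)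
  · refine ⟨eq_nil_of_forall_isPre_replicate fun n => ?_, rfl⟩
    obtain ⟨l, hl, hn⟩ := exists_isPre_le_count false n
    exact (morph_nil_right f l ▸ h l hl).of_prefix (replicate_flatten_prefix hn f)

/-- A nonempty f begins with a, and a occurs only at even positions. Since fg and fgf are both
followed by f, both are interleavings, hence so are f and g. -/
theorem IsXPre.exists_eq_interleave_pair {f g : List Letter}
    (h : IsXPre (f ++ g ++ f ++ f ++ g ++ f ++ g)) :
    ∃ f0 g0, f = interleave f0 ∧ g = interleave g0 := by
  rcases f with _ | ⟨x, f⟩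
  · rcases g with _ | ⟨z, g⟩
    · exact ⟨[], [], rfl, rfl⟩
    · simp only [List.append_nil, List.nil_append] at h
      obtain rfl := IsXPre.head_eq (l := g ++ z :: g ++ z :: g) (by simpa using h)
      obtain ⟨u, hu⟩ := h.of_append.exists_eq_interleave
      exact ⟨[], u, rfl, hu⟩
  · obtain rfl := IsXPre.head_eq (l := f) (h.of_append.of_append.of_append.of_append.of_append
      |>.of_append)
    obtain ⟨u, hu⟩ := h.of_append.of_append.of_append.of_append.exists_eq_interleave
    obtain ⟨v, hv⟩ := h.of_append.of_append.of_append.exists_eq_interleave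
    rw [hu] at hv
    obtain ⟨f0, hf⟩ := eq_interleave_of_append hv
    rw [hf] at hu
    obtain ⟨g0, hg⟩ := eq_interleave_of_append hu
    exact ⟨f0, g0, hf, hg⟩

theorem exists_iterate_of_mem_stab {φ : Morphism Letter} (hφ : φ ∈ Stab xGamma) :
    ∃ k, ∀ x, (φ (FreeMonoid.of Letter.a)).toList ++ (φ (FreeMonoid.of (boolLetter x))).toList =
      interleave (subst^[k] [x]) := by
  set Φ : Letter → List Letter := fun α => (φ (FreeMonoid.of α)).toList with hΦ
  have himg : ∀ w, IsXPre w → IsXPre (w.flatMap Φ) := fun w hw => by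
    have h1 := congrArg FreeMonoid.toList (hφ.1 w.length)
    have h2 : w.flatMap Φ = (φ (factorAt xGamma 0 w.length)).toList := by
      rw [toList_apply, ← hw.eq_factorAt]
    rw [h2, h1]
    exact isXPre_factorAt _
  have hstart := himg _ isPre_start.isXPre
  obtain ⟨f, g, hf, hg⟩ := IsXPre.exists_eq_interleave_pair
    (f := Φ Letter.a ++ Φ Letter.c) (g := Φ Letter.a ++ Φ Letter.b)
    -- The twelve letters of `isPre_start` are 0100101, which gives f g f f g f g, followed by these
    -- five.
    (IsXPre.of_append (r := [false, true, false, false, true].flatMap fun x =>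
      Φ Letter.a ++ Φ (boolLetter x)) (by simpa [boolLetter] using hstart))
  have hmorph : ∀ l, (interleave l).flatMap Φ = interleave (morph f g l) := fun l => by
    induction l with
    | nil => rfl
    | cons x l ih => cases x <;> simp [ih, ← hf, ← hg]
  have hpre : ∀ l, IsPre l → IsPre (morph f g l) := fun l hl =>
    isPre_of_isXPre (hmorph l ▸ himg _ hl.isXPre)
  -- This is where the infinitude of φ(`xGamma`) enters.
  have hne : ¬ (f = [] ∧ g = []) := by
    rintro ⟨rfl, rfl⟩
    obtain ⟨n, hn⟩ := hφ.2 1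
    obtain ⟨k, t, ht⟩ := (isXPre_factorAt n).exists_prefix_interleave
    change 1 ≤ (FreeMonoid.toList (φ _)).length at hn
    have := congrArg List.length (hmorph (pref k))
    rw [← ht, List.flatMap_append, ← toList_apply, List.length_append, morph_nil_left] at this
    simp only [List.flatten_replicate_nil, interleave_nil, List.length_nil] at this
    omega
  obtain ⟨hf0, hg0⟩ := ne_nil_of_morph hpre hne
  obtain ⟨k, rfl, rfl⟩ := exists_iterate_of_stab hf0 hg0 hpre
  exact ⟨k, fun x => by cases x; exacts [hf, hg]⟩

end HKS

theorem theorem1 :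
    HKS.IsPrimitive HKS.gamma ∧
    (HKS.xGamma 0 = HKS.Letter.a ∧ HKS.MapsTo HKS.gamma HKS.xGamma HKS.xGamma) ∧
    (∀ y : ℕ → HKS.Letter, y 0 = HKS.Letter.a → HKS.MapsTo HKS.gamma y y → y = HKS.xGamma) ∧
    HKS.IsPalindromic HKS.xGamma ∧
    (∀ φ ∈ HKS.Stab HKS.xGamma, φ ≠ 1 → ¬ HKS.HasConjugateInClassP φ) ∧
    ¬ HKS.HofKnillSimonAssertion HKS.Letter := by
  have hstab : ∀ φ ∈ HKS.Stab HKS.xGamma, φ ≠ 1 → ¬ HKS.HasConjugateInClassP φ :=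
    fun φ hφ hφ1 =>
      let ⟨_, hk⟩ := HKS.exists_iterate_of_mem_stab hφ
      HKS.not_hasConjugateInClassP hφ1 hk
  refine ⟨HKS.isPrimitive_gamma, ⟨HKS.xGamma_zero, HKS.mapsTo_gamma⟩,
    fun _ => HKS.eq_xGamma, HKS.isPalindromic_xGamma, hstab, fun h => ?_⟩
  obtain ⟨ψ, hψ, h1, hP⟩ :=
    (h HKS.gamma HKS.xGamma HKS.isPrimitive_gamma HKS.mapsTo_gamma).1 HKS.isPalindromic_xGamma
  exact hstab ψ hψ h1 hP
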